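/- Let $S_n$ be the group of permutations $\pi=[\pi(1),\dots,\pi(n)]$ of $\{1,\dots,n\}$, with $(\pi\cdot\rho)(i)=\pi(\rho(i))$, and for $1\le p\le n-1$ let $s(p)\in S_n$ be the transposition interchanging $p$ and $p+1$. Call $\pi,\rho\in S_n$ adjacent if $\rho=\pi\cdot s(p_1)\cdots s(p_k)$ for some $k\ge 0$ and some $p_1,\dots,p_k$ with $|p_i-p_j|\ge 2$ for all $i\ne j$. A tangle is a finite sequence $\pi_0,\dots,\pi_d$ $(d\ge 0)$ of permutations in $S_n$ in which each consecutive pair is adjacent; it performs $\pi$ if $\pi_0$ is the identity and $\pi_d=\pi$. A move of an element $i$ in the tangle is a maximal interval of times $\{a,a+1,\dots,b\}\subseteq\{0,\dots,d\}$ with $a<b$ on which the positions $\pi_a^{-1}(i),\pi_{a+1}^{-1}(i),\dots,\pi_b^{-1}(i)$ of $i$ form an arithmetic progression with common difference $+1$ or one with common difference $-1$. Theorem. For every $n$ and every permutation $\pi\in S_n$ there is a tangle performing $\pi$ in which the total number of moves, summed over all elements $i=1,\dots,n$, is at most $4n$. -/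

import Mathlib

/-- The swap `s(p)`, interchanging the neighbouring positions `p` and `p + 1`
(positions are numbered `0, …, n - 1`). -/
def adjSwap {n : ℕ} (p : Fin (n - 1)) : Equiv.Perm (Fin n) :=
  Equiv.swap ⟨p, by omega⟩ ⟨p + 1, by omega⟩

/-- Two permutations are adjacent if they are related by a collection of non-overlapping swaps:
`ρ = π · s(p₁) ⋯ s(pₖ)` with `|pᵢ - pⱼ| ≥ 2` for `i ≠ j`.  The product of permutations is
`(π * σ) i = π (σ i)`. -/
def PermAdjacent {n : ℕ} (π ρ : Equiv.Perm (Fin n)) : Prop :=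
  ∃ l : List (Fin (n - 1)),
    l.Pairwise (fun p q => 2 ≤ |((p : ℕ) : ℤ) - ((q : ℕ) : ℤ)|) ∧ ρ = π * (l.map adjSwap).prod

/-- A tangle of width `n`: a finite sequence `perm 0, …, perm depth` of permutations in which each
consecutive pair is adjacent.  (Values of `perm` beyond `depth` play no role.) -/
structure Tangle (n : ℕ) where
  depth : ℕ
  perm : ℕ → Equiv.Perm (Fin n)
  adjacent : ∀ t < depth, PermAdjacent (perm t) (perm (t + 1))

namespace Tangle

variable {n : ℕ}

/-- `T` performs `π` if it starts with the identity and ends with `π`. -/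
def Performs (T : Tangle n) (π : Equiv.Perm (Fin n)) : Prop :=
  T.perm 0 = 1 ∧ T.perm T.depth = π

/-- The position of element `i` in the `t`-th permutation, that is, path `i` at time `t`. -/
def pos (T : Tangle n) (i : Fin n) (t : ℕ) : ℤ :=
  (((T.perm t)⁻¹ i : Fin n) : ℕ)

/-- Between the times `a < b`, path `i` is a line segment whose position changes by `ε` in every
time step. -/
def IsSegment (T : Tangle n) (i : Fin n) (ε : ℤ) (a b : ℕ) : Prop :=
  a < b ∧ b ≤ T.depth ∧ ∀ t, a ≤ t → t < b → T.pos i (t + 1) = T.pos i t + ε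

/-- A move of path `i`: a maximal non-vertical line segment of the path (from time `a` to
time `b`). -/
def IsMove (T : Tangle n) (i : Fin n) (a b : ℕ) : Prop :=
  ∃ ε : ℤ, (ε = 1 ∨ ε = -1) ∧ T.IsSegment i ε a b ∧
    ∀ a' b', a' ≤ a → b ≤ b' → T.IsSegment i ε a' b' → a' = a ∧ b' = b

open Classical in
/-- The number of moves in path `i`. -/
noncomputable def pathMoves (T : Tangle n) (i : Fin n) : ℕ :=
  ((Finset.range (T.depth + 1) ×ˢ Finset.range (T.depth + 1)).filter
    (fun ab => T.IsMove i ab.1 ab.2)).card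

/-- The total number of moves in all paths. -/
noncomputable def totalMoves (T : Tangle n) : ℕ :=
  ∑ i : Fin n, T.pathMoves i

end Tangle

/-! In the odd-even network of `n` layers, any two wires cross exactly once. Along a wire, position
plus time keeps its parity until the wire rests, and this parity fixes the direction of travel. So a
path can turn only after a rest, and it has at most one move more than it has rests.

To perform `π`, delete some crossings: deleting one makes its two wires exchange their elements.
With `C t` the exchanges in layer `t`, the permutation at time `t` is `orderedProd C t * wireAt n t`
(position to wire to element), so the exchanges have to compose to `π * (wireAt n n)⁻¹`. By
`exists_orderedProd_eq_of_meet`, at most `n` exchanges suffice: the wires are settled one by one,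
each at the cost of at most one exchange.

The bound `4 * n` is `n` for the first moves of the paths, `n` for rests at the two ends of the
network (`sum_card_filter_layer_eq_self_le`), and `2 * n` for rests at deleted crossings. -/

open Equiv in
/-- The product `C 0 * C 1 * ⋯ * C (t - 1)`. -/
def orderedProd {α : Type*} (C : ℕ → Perm α) (t : ℕ) : Perm α :=
  ((List.range t).map C).prod

/-! ### Factoring a permutation into few exchanges at prescribed meeting times. -/

section OrderedProd

open Equiv

variable {α : Type*}

theorem Equiv.Perm.inv_apply_apply (f : Perm α) (x : α) : f⁻¹ (f x) = x := f.symm_apply_apply x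

theorem orderedProd_zero (C : ℕ → Perm α) : orderedProd C 0 = 1 := rfl

theorem orderedProd_succ (C : ℕ → Perm α) (t : ℕ) :
    orderedProd C (t + 1) = orderedProd C t * C t :=
  List.prod_range_succ C t

theorem orderedProd_update_of_le (C : ℕ → Perm α) (s : ℕ) (D : Perm α) (t : ℕ) (h : t ≤ s) :
    orderedProd (Function.update C s D) t = orderedProd C t := by
  induction t with
  | zero => rfl
  | succ t ih =>
    rw [orderedProd_succ, orderedProd_succ, ih (by omega), Function.update_of_ne (by omega)]

/-- Pulling the swap to the front through the factors up to index `s` conjugates it by their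
product. -/
theorem orderedProd_update_mul_swap [DecidableEq α] (C : ℕ → Perm α) (s : ℕ) (x y : α) (t : ℕ)
    (h : s < t) :
    orderedProd (Function.update C s (C s * swap x y)) t =
      swap (orderedProd C (s + 1) x) (orderedProd C (s + 1) y) * orderedProd C t := by
  induction t, h using Nat.le_induction with
  | base =>
    rw [Nat.succ_eq_add_one, orderedProd_succ, orderedProd_update_of_le _ _ _ _ le_rfl,
      Function.update_self, ← mul_assoc, ← orderedProd_succ, mul_swap_eq_swap_mul]
  | succ t ht ih =>
    rw [orderedProd_succ, ih, Function.update_of_ne (by omega), orderedProd_succ C t, mul_assoc]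

/-- Suppose that the involutions `M 0, …, M (T - 1)` match any two elements `i ≠ j` exactly once,
at time `τ i j`, and that no pair meets strictly between its meetings with a smaller element. Then
every permutation is a time-ordered product of parts of these matchings that move few elements
altogether. -/
theorem exists_orderedProd_eq_of_meet [Fintype α] [LinearOrder α] (T : ℕ) (M : ℕ → Perm α)
    (τ : α → α → ℕ) (hM : ∀ t i, M t (M t i) = i)
    (hτ : ∀ i j, i ≠ j → τ i j < T)
    (hmeet : ∀ i j, i ≠ j → ∀ t < T, (M t i = j ↔ t = τ i j))
    (hbetween : ∀ l i j, l < i → l < j → i ≠ j → τ l i < τ i j → τ i j < τ l j → False)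
    (S : Finset α) :
    ∀ ρ : Perm α, (∀ i ∉ S, ρ i = i) →
      ∃ C : ℕ → Perm α, (∀ t i, C t i = i ∨ C t i = M t i) ∧ (∀ t i, C t (C t i) = i) ∧
        (∀ t, ∀ i ∉ S, C t i = i) ∧ orderedProd C T = ρ ∧
        ∑ t ∈ Finset.range T, (C t).support.card ≤ 2 * S.card := by
  induction S using Finset.induction_on_min with
  | empty =>
    intro ρ hρ
    have hρ1 : ρ = 1 := Equiv.ext fun i => hρ i (Finset.notMem_empty i)
    exact ⟨fun _ => 1, by simp, by simp, by simp, by simp [orderedProd, hρ1], by simp⟩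
  | insert l S hl ih =>
    intro ρ hρ
    have hlS : l ∉ S := fun h => lt_irrefl _ (hl l h)
    set a := ρ l with ha
    -- Now `l` is fixed as well, so the induction hypothesis gives exchanges that avoid `l`. One
    -- further exchange with `l` has to supply `swap l a`.
    have hρ' : ∀ i ∉ S, (swap l a * ρ) i = i := by
      intro i hi
      by_cases hil : i = l
      · subst hil; simp [← ha]
      · have h1 : ρ i = i := hρ i (by simp [hil, hi])
        have h2 : i ≠ a := fun h => hil (ρ.injective (h1.trans h))
        simp [h1, swap_apply_of_ne_of_ne hil h2]
    obtain ⟨C, hCM, hCC, hCS, hCρ, hcard⟩ := ih _ hρ'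
    by_cases hal : a = l
    · refine ⟨C, hCM, hCC, fun t i hi => hCS t i fun h => hi (Finset.mem_insert_of_mem h), ?_, ?_⟩
      · rw [hCρ, hal, swap_self]; rfl
      · rw [Finset.card_insert_of_notMem hlS]; omega
    have hCl : ∀ t, C t l = l := fun t => hCS t l hlS
    have haS : a ∈ S := by
      by_contra h
      have : ρ a = a := hρ a (by simp [hal, h])
      exact hal (ρ.injective this)
    -- `x t` is the wire that carries the element `a` at time `t`.
    set x : ℕ → α := fun t => (orderedProd C t)⁻¹ a with hx
    have hx0 : x 0 = a := rfl
    have hxs : ∀ t, x (t + 1) = C t (x t) := by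
      intro t
      have : (C t)⁻¹ (x t) = C t (x t) := by
        rw [Perm.inv_eq_iff_eq, hCC]
      rw [← this]
      simp only [hx, orderedProd_succ, mul_inv_rev, Perm.mul_apply]
    have hxl : ∀ t, x t ∈ S := by
      intro t
      induction t with
      | zero => rwa [hx0]
      | succ t iht =>
        rw [hxs]
        by_contra h
        have := hCS t _ h
        rw [hCC] at this
        rw [← this] at h
        exact h iht
    have hne : ∀ t, l ≠ x t := fun t => (hl _ (hxl t)).ne
    -- the element that has to end in `l` meets `l` at some time
    obtain ⟨s, hsT, hs⟩ : ∃ s < T, s = τ l (x s) := by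
      -- Take the first time at which the wire carrying `a` has already met `l`; the step just
      -- before it is the meeting.
      have hex : ∃ t, τ l (x t) < t := ⟨T, hτ _ _ (hne T)⟩
      obtain ⟨t, ht⟩ : ∃ t, Nat.find hex = t + 1 := by
        refine Nat.exists_eq_succ_of_ne_zero fun h => ?_
        have := Nat.find_spec hex
        rw [h] at this
        omega
      have h1 : τ l (x (t + 1)) < t + 1 := ht ▸ Nat.find_spec hex
      have h2 : t ≤ τ l (x t) := not_lt.1 (Nat.find_min hex (by omega))
      have htT : t < T := lt_of_le_of_lt h2 (hτ _ _ (hne t))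
      refine ⟨t, htT, ?_⟩
      by_contra h3
      by_cases h4 : C t (x t) = x t
      · rw [hxs, h4] at h1; omega
      have h5 : M t (x t) = x (t + 1) := by
        rw [hxs]
        exact ((hCM t (x t)).resolve_left h4).symm
      have h6 : x (t + 1) ≠ x t := by rwa [hxs]
      have h7 : t = τ (x (t + 1)) (x t) :=
        (hmeet _ _ h6 t htT).1 (by rw [← h5, hM])
      have h8 : t ≠ τ l (x (t + 1)) := fun h => by
        have := (hmeet _ _ (hne _) t htT).2 h
        rw [← h5] at this
        exact hne _ ((M t).injective this)
      -- Otherwise `a` changes at time `t` from a wire that has yet to meet `l` to one that has met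
      -- it before.
      exact hbetween l _ _ (hl _ (hxl (t + 1))) (hl _ (hxl t)) h6 (by omega) (by omega)
    have hMl : M s l = x s := (hmeet _ _ (hne s) s hsT).2 hs
    have hMx : M s (x s) = l := by rw [← hMl, hM]
    -- The only possible partner of `x s` at time `s` is `l`, which `C s` fixes; so the new swap is
    -- disjoint from `C s`.
    have hCx : C s (x s) = x s := by
      rcases hCM s (x s) with h | h
      · exact h
      · have := hCl s
        rw [← hMx, ← h, hCC, h, hMx] at this
        exact absurd this.symm (hne s)
    have hmain : ∀ i, i ≠ l → i ≠ x s → C s i ≠ l ∧ C s i ≠ x s := fun i h1 h2 =>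
      ⟨fun h => h1 ((C s).injective (h.trans (hCl s).symm)),
        fun h => h2 ((C s).injective (h.trans hCx.symm))⟩
    have hDl : (C s * swap l (x s)) l = x s := by simp [hCx]
    have hDx : (C s * swap l (x s)) (x s) = l := by simp [hCl]
    have hDi : ∀ i, i ≠ l → i ≠ x s → (C s * swap l (x s)) i = C s i := fun i h1 h2 => by
      simp [swap_apply_of_ne_of_ne h1 h2]
    refine ⟨Function.update C s (C s * swap l (x s)), ?_, ?_, ?_, ?_, ?_⟩
    · intro t i
      rcases eq_or_ne t s with rfl | hts
      · rw [Function.update_self]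
        by_cases h1 : i = l
        · subst h1; right; rw [hDl, hMl]
        by_cases h2 : i = x t
        · subst h2; right; rw [hDx, hMx]
        rw [hDi i h1 h2]; exact hCM t i
      · rw [Function.update_of_ne hts]; exact hCM t i
    · intro t i
      rcases eq_or_ne t s with rfl | hts
      · rw [Function.update_self]
        by_cases h1 : i = l
        · subst h1; rw [hDl, hDx]
        by_cases h2 : i = x t
        · subst h2; rw [hDx, hDl]
        rw [hDi i h1 h2, hDi _ (hmain i h1 h2).1 (hmain i h1 h2).2, hCC]
      · rw [Function.update_of_ne hts]; exact hCC t i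
    · intro t i hi
      rw [Finset.mem_insert, not_or] at hi
      rcases eq_or_ne t s with rfl | hts
      · rw [Function.update_self, hDi i hi.1 fun h => hi.2 (h ▸ hxl t), hCS t i hi.2]
      · rw [Function.update_of_ne hts, hCS t i hi.2]
    · have hl' : ∀ t, orderedProd C t l = l := by
        intro t
        induction t with
        | zero => rfl
        | succ t iht => rw [orderedProd_succ, Perm.mul_apply, hCl, iht]
      have ha' : orderedProd C (s + 1) (x s) = a := by
        rw [orderedProd_succ, Perm.mul_apply, hCx]; simp [hx]
      rw [orderedProd_update_mul_swap _ _ _ _ _ hsT, hl', ha', hCρ, ← mul_assoc, swap_mul_self,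
        one_mul]
    · rw [Finset.card_insert_of_notMem hlS]
      have hD : (C s * swap l (x s)).support.card ≤ (C s).support.card + 2 := by
        refine (Finset.card_le_card (Perm.support_mul_le _ _)).trans
          ((Finset.card_union_le _ _).trans ?_)
        rw [Perm.card_support_swap (hne s)]
      have hsm : s ∈ Finset.range T := Finset.mem_range.2 hsT
      have h1 := Finset.add_sum_erase _ (fun t => (C t).support.card) hsm
      have h2 := Finset.add_sum_erase _
        (fun t => (Function.update C s (C s * swap l (x s)) t).support.card) hsm
      have h3 : ∑ t ∈ (Finset.range T).erase s,
          (Function.update C s (C s * swap l (x s)) t).support.card =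
            ∑ t ∈ (Finset.range T).erase s, (C t).support.card :=
        Finset.sum_congr rfl fun t ht => by
          rw [Function.update_of_ne (Finset.ne_of_mem_erase ht)]
      simp only [Function.update_self] at h2
      omega

end OrderedProd

/-! ### The odd-even network and the crossing times of its wires. -/

section OddEvenNetwork

open Equiv

/-- The position to which layer `t` of the odd-even network takes position `p`. -/
def layerFun (n t p : ℕ) : ℕ :=
  if (p + t) % 2 = 0 then (if p + 1 < n then p + 1 else p) else p - 1

theorem layerFun_lt {n t p : ℕ} (h : p < n) : layerFun n t p < n := by
  unfold layerFun; split_ifs <;> omega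

theorem layerFun_layerFun {n t p : ℕ} (h : p < n) : layerFun n t (layerFun n t p) = p := by
  unfold layerFun; split_ifs <;> omega

/-- Layer `t` of the odd-even network, which swaps all positions `p`, `p + 1` with `p + t` even. -/
def layer (n t : ℕ) : Perm (Fin n) :=
  Function.Involutive.toPerm (fun p => ⟨layerFun n t p, layerFun_lt p.2⟩)
    fun p => Fin.ext (layerFun_layerFun p.2)

theorem layer_val (n t : ℕ) (p : Fin n) : (layer n t p : ℕ) = layerFun n t p := rfl

theorem layer_layer (n t : ℕ) (p : Fin n) : layer n t (layer n t p) = p :=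
  Fin.ext (layerFun_layerFun p.2)

/-- The starting point of wire `s` on the circle of length `2 * n` that is folded onto the
positions, and around which all wires move at unit speed. -/
def wirePhase (n s : ℕ) : ℕ := if s % 2 = 0 then s else 2 * n - 1 - s

/-- The position of wire `s` of the odd-even network at time `t ≤ n`. -/
def wirePos (n t s : ℕ) : ℕ :=
  if wirePhase n s + t < n then wirePhase n s + t
  else if wirePhase n s + t < 2 * n then 2 * n - 1 - (wirePhase n s + t)
  else wirePhase n s + t - 2 * n

/-- The time at which wires `i` and `j` of the odd-even network cross. -/
def wireMeet (n i j : ℕ) : ℕ :=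
  if wirePhase n i + wirePhase n j + 2 ≤ 2 * n then
    (2 * n - 2 - wirePhase n i - wirePhase n j) / 2
  else (4 * n - 2 - wirePhase n i - wirePhase n j) / 2

/-- Even phases make position plus time even on the rising half of the circle and odd on the falling
half, in accordance with `layerFun`. They also make the halvings in `wireMeet` exact. -/
theorem wirePhase_even (n s : ℕ) : wirePhase n s % 2 = 0 := by
  unfold wirePhase; split_ifs <;> omega

theorem wirePhase_lt {n s : ℕ} (h : s < n) : wirePhase n s + 1 < 2 * n := by
  unfold wirePhase; split_ifs <;> omega

theorem wirePhase_ne {n i j : ℕ} (hi : i < n) (hj : j < n) (hij : i ≠ j) :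
    wirePhase n i ≠ wirePhase n j := by
  unfold wirePhase; split_ifs <;> omega

theorem wirePos_zero {n s : ℕ} (h : s < n) : wirePos n 0 s = s := by
  unfold wirePos wirePhase; split_ifs <;> omega

theorem wirePos_succ {n t s : ℕ} (h : s < n) (ht : t < n) :
    wirePos n (t + 1) s = layerFun n t (wirePos n t s) := by
  have h1 := wirePhase_even n s
  have h2 := wirePhase_lt h
  unfold wirePos layerFun
  generalize wirePhase n s = x at *
  split_ifs <;> omega

theorem wireMeet_lt {n i j : ℕ} (hi : i < n) (hj : j < n) (hij : i ≠ j) : wireMeet n i j < n := by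
  have h := wirePhase_ne hi hj hij
  have h1 := wirePhase_even n i
  have h2 := wirePhase_even n j
  unfold wireMeet
  generalize wirePhase n i = x at *
  generalize wirePhase n j = y at *
  split_ifs <;> omega

/-- A rising wire at `p` swaps with a falling one at `p + 1` when their points on the circle add up
to `2 * n - 2` modulo `2 * n`. This determines `t` modulo `n`. -/
theorem layerFun_wirePos_eq_iff {n t i j : ℕ} (hi : i < n) (hj : j < n) (hij : i ≠ j)
    (ht : t < n) : layerFun n t (wirePos n t i) = wirePos n t j ↔ t = wireMeet n i j := by
  have h := wirePhase_ne hi hj hij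
  have h1 := wirePhase_even n i
  have h2 := wirePhase_even n j
  have h3 := wirePhase_lt hi
  have h4 := wirePhase_lt hj
  unfold wireMeet layerFun wirePos
  generalize wirePhase n i = x at *
  generalize wirePhase n j = y at *
  split_ifs <;> omega

/-- Of the three crossings among three wires, the middle one in time is that of the two outer wires,
since the first crossing must involve the inner wire. A pair without the lowest wire `l` is
therefore never in the middle. -/
theorem not_wireMeet_between {n l i j : ℕ} (hi : i < n) (hj : j < n) (hli : l < i) (hlj : l < j)
    (h1 : wireMeet n l i < wireMeet n i j) (h2 : wireMeet n i j < wireMeet n l j) :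
    False := by
  unfold wireMeet wirePhase at *
  split_ifs at * <;> omega

/-- The wire at each position of the odd-even network at time `t`. -/
def wireAt (n t : ℕ) : Perm (Fin n) := orderedProd (layer n) t

theorem wireAt_inv_val {n t : ℕ} (ht : t ≤ n) (s : Fin n) :
    (((wireAt n t)⁻¹ s : Fin n) : ℕ) = wirePos n t s := by
  induction t with
  | zero => simp [wireAt, orderedProd_zero, wirePos_zero]
  | succ t ih =>
    have h : (wireAt n (t + 1))⁻¹ s = layer n t ((wireAt n t)⁻¹ s) := by
      rw [Perm.inv_eq_iff_eq, wireAt, orderedProd_succ, Perm.mul_apply, layer_layer]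
      simp [wireAt]
    rw [h, layer_val, ih (by omega), wirePos_succ s.2 (by omega)]

/-- The crossings of layer `t` of the odd-even network, as a matching of the wires. -/
def wireMatching (n t : ℕ) : Perm (Fin n) := wireAt n t * layer n t * (wireAt n t)⁻¹

theorem wireMatching_apply (n t : ℕ) (i : Fin n) :
    wireMatching n t i = wireAt n t (layer n t ((wireAt n t)⁻¹ i)) := rfl

theorem wireMatching_eq_iff {n t : ℕ} (ht : t < n) {i j : Fin n} (hij : i ≠ j) :
    wireMatching n t i = j ↔ t = wireMeet n i j := by
  rw [wireMatching_apply, ← Perm.eq_inv_iff_eq, Fin.ext_iff, layer_val, wireAt_inv_val ht.le,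
    wireAt_inv_val ht.le]
  exact layerFun_wirePos_eq_iff i.2 j.2 (fun h => hij (Fin.ext h)) ht

theorem exists_orderedProd_wireMatching (n : ℕ) (ρ : Perm (Fin n)) :
    ∃ C : ℕ → Perm (Fin n), (∀ t i, C t i = i ∨ C t i = wireMatching n t i) ∧
      (∀ t i, C t (C t i) = i) ∧ orderedProd C n = ρ ∧
      ∑ t ∈ Finset.range n, (C t).support.card ≤ 2 * n := by
  obtain ⟨C, h1, h2, -, h3, h4⟩ := exists_orderedProd_eq_of_meet n (wireMatching n)
    (fun i j => wireMeet n i j) (fun t i => by simp [wireMatching_apply, layer_layer])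
    (fun i j hij => wireMeet_lt i.2 j.2 fun h => hij (Fin.ext h))
    (fun i j hij t ht => wireMatching_eq_iff ht hij)
    (fun l i j hli hlj _ => not_wireMeet_between i.2 j.2 hli hlj)
    Finset.univ ρ (by simp)
  exact ⟨C, h1, h2, h3, by simpa using h4⟩

/-- Only the ends can rest: position `0` for odd `t`, by truncated subtraction in `layerFun`, and
position `n - 1` for odd `n + t`. -/
theorem card_filter_layer_eq_self_le (n t : ℕ) :
    (Finset.univ.filter fun p => layer n t p = p).card ≤ t % 2 + (n + t) % 2 := by
  classical
  have hsub : (Finset.univ.filter fun p => layer n t p = p).map Fin.valEmbedding ⊆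
      (if t % 2 = 1 then {0} else ∅) ∪ (if (n + t) % 2 = 1 then {n - 1} else ∅) := by
    intro q hq
    simp only [Finset.mem_map, Finset.mem_filter, Finset.mem_univ, true_and, Fin.ext_iff,
      layer_val] at hq
    obtain ⟨p, hp, rfl⟩ := hq
    have := p.2
    unfold layerFun at hp
    simp only [Fin.valEmbedding_apply, Finset.mem_union]
    split_ifs at * <;> simp <;> omega
  rw [← Finset.card_map Fin.valEmbedding]
  refine (Finset.card_le_card hsub).trans ((Finset.card_union_le _ _).trans ?_)
  split_ifs <;> simp <;> omega

theorem sum_card_filter_layer_eq_self_le (n : ℕ) :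
    ∑ t ∈ Finset.range n, (Finset.univ.filter fun p => layer n t p = p).card ≤ n := by
  refine (Finset.sum_le_sum fun t _ => card_filter_layer_eq_self_le n t).trans ?_
  rw [Finset.sum_add_distrib]
  have h1 : ∀ m, ∑ t ∈ Finset.range m, t % 2 = m / 2 := by
    intro m
    induction m with
    | zero => rfl
    | succ m ih => rw [Finset.sum_range_succ, ih]; omega
  have h2 : ∀ m, ∑ t ∈ Finset.range m, (n + t) % 2 = (n + m) / 2 - n / 2 := by
    intro m
    induction m with
    | zero => simp
    | succ m ih => rw [Finset.sum_range_succ, ih]; omega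
  rw [h1, h2]
  omega

end OddEvenNetwork

/-! ### Involutions with displacement at most one as products of non-overlapping swaps. -/

section Adjacency

open Equiv

variable {n : ℕ}

theorem adjSwap_apply_val (p : Fin (n - 1)) (x : Fin n) :
    (adjSwap p x : ℕ) = if (x : ℕ) = p then (p : ℕ) + 1 else if (x : ℕ) = p + 1 then p else x := by
  unfold adjSwap
  rw [swap_apply_def]
  simp only [Fin.ext_iff]
  split_ifs <;> rfl

/-- A product of non-overlapping swaps of neighbours acts as each of them does. -/
theorem prod_adjSwap_apply (l : List (Fin (n - 1)))
    (hl : l.Pairwise fun p q : Fin (n - 1) => 2 ≤ |((p : ℕ) : ℤ) - ((q : ℕ) : ℤ)|) (x : Fin n) :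
    (∀ p ∈ l, (x : ℕ) = p → ((l.map adjSwap).prod x : ℕ) = p + 1) ∧
    (∀ p ∈ l, (x : ℕ) = p + 1 → ((l.map adjSwap).prod x : ℕ) = p) ∧
    ((∀ p ∈ l, (x : ℕ) ≠ p ∧ (x : ℕ) ≠ p + 1) → ((l.map adjSwap).prod x : ℕ) = x) := by
  induction l with
  | nil => simp
  | cons q l ih =>
    rw [List.pairwise_cons] at hl
    obtain ⟨hq, hl⟩ := hl
    obtain ⟨ih1, ih2, ih3⟩ := ih hl
    have far : ∀ p ∈ l, (q : ℕ) + 2 ≤ p ∨ (p : ℕ) + 2 ≤ q := fun p hp => by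
      rcases le_abs.1 (hq p hp) with h | h <;> omega
    have hfix : (x : ℕ) = q ∨ (x : ℕ) = q + 1 → ((l.map adjSwap).prod x : ℕ) = x := fun h =>
      ih3 fun p hp => by have := far p hp; omega
    simp only [List.map_cons, List.prod_cons, Perm.mul_apply, adjSwap_apply_val]
    refine ⟨?_, ?_, ?_⟩
    · intro p hp hx
      rcases List.mem_cons.1 hp with rfl | hp
      · rw [hfix (Or.inl hx), if_pos hx]
      · have := far p hp
        rw [ih1 p hp hx, if_neg (by omega), if_neg (by omega)]
    · intro p hp hx
      rcases List.mem_cons.1 hp with rfl | hp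
      · rw [hfix (Or.inr hx), if_neg (by omega), if_pos hx]
      · have := far p hp
        rw [ih2 p hp hx, if_neg (by omega), if_neg (by omega)]
    · intro h
      have hxq := h q List.mem_cons_self
      rw [ih3 fun p hp => h p (List.mem_cons_of_mem _ hp), if_neg hxq.1, if_neg hxq.2]

/-- An involution that moves every position by at most one leads to an adjacent permutation. -/
theorem permAdjacent_mul_of_involutive (π σ : Perm (Fin n)) (hσ : ∀ p, σ (σ p) = p)
    (h1 : ∀ p, (σ p : ℕ) = p ∨ (σ p : ℕ) = p + 1 ∨ (σ p : ℕ) + 1 = p) :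
    PermAdjacent π (π * σ) := by
  classical
  have hlt : ∀ p : Fin (n - 1), (p : ℕ) < n := fun p => by omega
  set l := (List.finRange (n - 1)).filter fun p : Fin (n - 1) => (σ ⟨p, hlt p⟩ : ℕ) = p + 1 with hldef
  have hmem : ∀ p, p ∈ l ↔ (σ ⟨p, hlt p⟩ : ℕ) = p + 1 := fun p => by simp [hldef]
  have hl : l.Pairwise fun p q : Fin (n - 1) => 2 ≤ |((p : ℕ) : ℤ) - ((q : ℕ) : ℤ)| := by
    refine List.Pairwise.imp_of_mem ?_ ((List.nodup_finRange (n - 1)).filter _)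
    intro p q hp hq hpq
    rw [hmem] at hp hq
    have hne : (p : ℕ) ≠ q := fun h => hpq (Fin.ext h)
    -- Two overlapping swaps would give `σ (σ a) = a + 2`, against involutivity.
    have key : ∀ a b : Fin (n - 1), (σ ⟨a, hlt a⟩ : ℕ) = a + 1 → (σ ⟨b, hlt b⟩ : ℕ) = b + 1 →
        (b : ℕ) ≠ a + 1 := by
      intro a b ha hb hab
      have h2 : σ ⟨a, hlt a⟩ = ⟨b, hlt b⟩ := Fin.ext (by simp [ha, hab])
      have h3 := hσ ⟨a, hlt a⟩
      rw [h2, Fin.ext_iff, hb] at h3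
      simp only at h3
      omega
    have h4 := key p q hp hq
    have h5 := key q p hq hp
    rw [le_abs]
    omega
  refine ⟨l, by simpa [← List.map_eq_flatMap, List.pairwise_map] using hl, ?_⟩
  congr 1
  ext x
  obtain ⟨hA, hB, hC⟩ := prod_adjSwap_apply l hl x
  have hx := x.2
  rcases h1 x with h | h | h
  · rw [h, hC]
    intro p hp
    rw [hmem] at hp
    refine ⟨fun hxp => ?_, fun hxp => ?_⟩
    · have : (⟨p, hlt p⟩ : Fin n) = x := Fin.ext hxp.symm
      rw [this] at hp
      omega
    · have h2 : σ ⟨p, hlt p⟩ = x := Fin.ext (by omega)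
      have h3 := hσ ⟨p, hlt p⟩
      rw [h2, Fin.ext_iff] at h3
      simp only at h3
      omega
  · have h2 := (σ x).2
    rw [h]
    exact (hA ⟨x, by omega⟩ ((hmem _).2 h) rfl).symm
  · have h2 : (⟨(σ x : ℕ), by omega⟩ : Fin n) = σ x := rfl
    exact (hB ⟨σ x, by omega⟩ ((hmem _).2 (by simp only [h2, hσ]; omega)) h.symm).symm

end Adjacency

/-! ### Bounding moves by rests. -/

section Moves

variable {n : ℕ}

/-- If a path never passes from one slope to a different non-zero slope without a rest, it has at
most one move more than rests. -/
theorem Tangle.pathMoves_le (T : Tangle n) (i : Fin n)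
    (h : ∀ t, t + 1 < T.depth → T.pos i (t + 1) ≠ T.pos i t →
      T.pos i (t + 2) ≠ T.pos i (t + 1) →
      T.pos i (t + 2) - T.pos i (t + 1) = T.pos i (t + 1) - T.pos i t) :
    T.pathMoves i ≤
      1 + ((Finset.range T.depth).filter fun t => T.pos i (t + 1) = T.pos i t).card := by
  classical
  rw [add_comm, ← Finset.card_map (addRightEmbedding 1) (s := Finset.filter _ _)]
  refine le_trans ?_ (Finset.card_insert_le 0 _)
  unfold Tangle.pathMoves
  -- A move is determined by its starting time, which is `0` or `t + 1` for a rest in step `t`.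
  refine Finset.card_le_card_of_injOn Prod.fst ?_ ?_
  · rintro ⟨a, b⟩ hab
    simp only [Finset.coe_filter, Set.mem_ofPred_eq] at hab
    obtain ⟨-, ε, hε, ⟨hlt, hb, hseg⟩, hmax⟩ := hab
    simp only [Finset.coe_insert, Set.mem_insert_iff, Finset.mem_coe, Finset.mem_map,
      Finset.mem_filter, Finset.mem_range, addRightEmbedding_apply]
    rcases a with _ | a
    · exact Or.inl rfl
    refine Or.inr ⟨a, ⟨by omega, ?_⟩, rfl⟩
    by_contra hne
    have h1 : T.pos i (a + 2) = T.pos i (a + 1) + ε := hseg (a + 1) le_rfl hlt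
    have h2 := h a (by omega) hne (by omega)
    have := hmax a b (by omega) le_rfl ⟨by omega, hb, fun t hat htb => by
      rcases Nat.eq_or_lt_of_le hat with rfl | hat
      · omega
      · exact hseg t hat htb⟩
    omega
  · rintro ⟨a, b⟩ hab ⟨a', b'⟩ hab' heq
    simp only [Finset.coe_filter, Set.mem_ofPred_eq] at hab hab' heq
    subst heq
    obtain ⟨-, ε, hε, hs, hmax⟩ := hab
    obtain ⟨-, ε', hε', hs', hmax'⟩ := hab'
    have h1 := hs.2.2 a le_rfl hs.1
    have h2 := hs'.2.2 a le_rfl hs'.1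
    obtain rfl : ε = ε' := by omega
    rcases le_total b b' with hb | hb
    · rw [(hmax a b' le_rfl hb hs').2]
    · rw [(hmax' a b le_rfl hb hs).2]

end Moves

/-! ### The tangle obtained by deleting crossings from the network. -/

section Construction

open Equiv

variable {n : ℕ}

/-- The swaps of layer `t` of the odd-even network that remain when the wires exchange their
elements according to `C t`. -/
def keptLayer (C : ℕ → Perm (Fin n)) (t : ℕ) : Perm (Fin n) :=
  (wireAt n t)⁻¹ * C t * wireAt n t * layer n t

theorem orderedProd_mul_wireAt_succ (C : ℕ → Perm (Fin n)) (t : ℕ) :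
    orderedProd C (t + 1) * wireAt n (t + 1) = orderedProd C t * wireAt n t * keptLayer C t := by
  simp only [keptLayer, wireAt, orderedProd_succ]
  group

/-- Where `C t` exchanges the elements of two crossing wires, it cancels the crossing, and both
elements stay in place. -/
theorem keptLayer_apply_eq (C : ℕ → Perm (Fin n)) {t : ℕ}
    (hM : ∀ i, C t i = i ∨ C t i = wireMatching n t i) (p : Fin n) :
    keptLayer C t p = layer n t p ∨
      keptLayer C t p = p ∧ C t (wireAt n t (layer n t p)) = wireAt n t p := by
  have h : keptLayer C t p = (wireAt n t)⁻¹ (C t (wireAt n t (layer n t p))) := rfl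
  rcases hM (wireAt n t (layer n t p)) with h1 | h1
  · left; rw [h, h1, Perm.inv_apply_apply]
  · right
    rw [wireMatching_apply, Perm.inv_apply_apply, layer_layer] at h1
    exact ⟨by rw [h, h1, Perm.inv_apply_apply], h1⟩

theorem keptLayer_keptLayer (C : ℕ → Perm (Fin n)) {t : ℕ}
    (hM : ∀ i, C t i = i ∨ C t i = wireMatching n t i) (hC : ∀ i, C t (C t i) = i) (p : Fin n) :
    keptLayer C t (keptLayer C t p) = p := by
  rcases keptLayer_apply_eq C hM p with h | ⟨h, -⟩
  · rw [h]
    rcases keptLayer_apply_eq C hM (layer n t p) with h2 | ⟨h2, h3⟩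
    · rw [h2, layer_layer]
    · rw [layer_layer] at h3
      have h5 : keptLayer C t p = (wireAt n t)⁻¹ (C t (wireAt n t (layer n t p))) := rfl
      rw [← h3, hC, Perm.inv_apply_apply] at h5
      rw [h2, ← h, h5]
  · rw [h, h]

theorem card_filter_keptLayer_eq_self_le (C : ℕ → Perm (Fin n)) {t : ℕ}
    (hM : ∀ i, C t i = i ∨ C t i = wireMatching n t i) (hC : ∀ i, C t (C t i) = i) :
    (Finset.univ.filter fun p => keptLayer C t p = p).card ≤
      (Finset.univ.filter fun p => layer n t p = p).card + (C t).support.card := by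
  classical
  rw [← Finset.card_map (wireAt n t)⁻¹.toEmbedding (s := (C t).support)]
  refine (Finset.card_le_card ?_).trans (Finset.card_union_le _ _)
  intro p hp
  simp only [Finset.mem_filter, Finset.mem_univ, true_and, Finset.mem_union, Finset.mem_map,
    Perm.mem_support] at hp ⊢
  by_cases h0 : layer n t p = p
  · exact Or.inl h0
  · refine Or.inr ⟨wireAt n t p, fun h1 => ?_, by simp⟩
    rcases keptLayer_apply_eq C hM p with h | ⟨-, h⟩
    · exact h0 (h.symm.trans hp)
    · rw [← h, hC] at h1
      exact h0 ((wireAt n t).injective (h1.trans h))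

theorem layerFun_cases (n t p : ℕ) :
    layerFun n t p = p ∨ ((p + t) % 2 = 0 ∧ layerFun n t p = p + 1) ∨
      ((p + t) % 2 = 1 ∧ layerFun n t p + 1 = p) := by
  unfold layerFun; split_ifs <;> omega

theorem exists_tangle_of_schedule (C : ℕ → Perm (Fin n))
    (hM : ∀ t i, C t i = i ∨ C t i = wireMatching n t i) (hC : ∀ t i, C t (C t i) = i) :
    ∃ T : Tangle n, T.Performs (orderedProd C n * wireAt n n) ∧
      T.totalMoves ≤ 2 * n + ∑ t ∈ Finset.range n, (C t).support.card := by
  classical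
  have hval : ∀ t (p : Fin n), (keptLayer C t p : ℕ) = p ∨
      (((p : ℕ) + t) % 2 = 0 ∧ (keptLayer C t p : ℕ) = p + 1) ∨
      (((p : ℕ) + t) % 2 = 1 ∧ (keptLayer C t p : ℕ) + 1 = p) := by
    intro t p
    rcases keptLayer_apply_eq C (hM t) p with h | ⟨h, -⟩
    · rw [h, layer_val]; exact layerFun_cases n t p
    · exact Or.inl (by rw [h])
  let T : Tangle n :=
    { depth := n
      perm := fun t => orderedProd C t * wireAt n t
      adjacent := fun t _ => by
        rw [orderedProd_mul_wireAt_succ]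
        exact permAdjacent_mul_of_involutive _ _ (keptLayer_keptLayer C (hM t) (hC t))
          fun p => by have := hval t p; omega }
  have hstep : ∀ t i, (T.perm (t + 1))⁻¹ i = keptLayer C t ((T.perm t)⁻¹ i) := by
    intro t i
    rw [Perm.inv_eq_iff_eq]
    change i = (orderedProd C (t + 1) * wireAt n (t + 1)) _
    rw [orderedProd_mul_wireAt_succ, Perm.mul_apply, keptLayer_keptLayer C (hM t) (hC t)]
    exact ((T.perm t).apply_symm_apply i).symm
  have hpos : ∀ t i, T.pos i (t + 1) = ((keptLayer C t ((T.perm t)⁻¹ i) : Fin n) : ℕ) :=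
    fun t i => by rw [← hstep]; rfl
  have hpos' : ∀ t i, T.pos i t = (((T.perm t)⁻¹ i : Fin n) : ℕ) := fun _ _ => rfl
  have hmoves : ∀ i, T.pathMoves i ≤
      1 + ((Finset.range n).filter fun t => T.pos i (t + 1) = T.pos i t).card := by
    intro i
    -- By `hval`, the parity of position plus time decides the direction, and a move in either
    -- direction preserves this parity.
    refine T.pathMoves_le i fun t _ h1 h2 => ?_
    have e0 := hpos' t i
    have e1 := hpos t i
    have e2 := hpos' (t + 1) i
    have e3 := hpos (t + 1) i
    have c0 := hval t ((T.perm t)⁻¹ i)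
    have c1 := hval (t + 1) ((T.perm (t + 1))⁻¹ i)
    rw [add_assoc] at e3
    norm_num only at e3
    omega
  have hrest : ∑ i, ((Finset.range n).filter fun t => T.pos i (t + 1) = T.pos i t).card =
      ∑ t ∈ Finset.range n, (Finset.univ.filter fun p => keptLayer C t p = p).card := by
    simp only [Finset.card_filter]
    rw [Finset.sum_comm]
    refine Finset.sum_congr rfl fun t _ => ?_
    refine Fintype.sum_equiv (T.perm t)⁻¹ _ _ fun i => ?_
    simp only [hpos, hpos', Nat.cast_inj, Fin.ext_iff]
  refine ⟨T, ⟨?_, rfl⟩, ?_⟩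
  · simp [T, wireAt, orderedProd_zero]
  · have h1 : T.totalMoves ≤ ∑ i : Fin n,
        (1 + ((Finset.range n).filter fun t => T.pos i (t + 1) = T.pos i t).card) :=
      Finset.sum_le_sum fun i _ => hmoves i
    have h2 := Finset.sum_le_sum fun t (_ : t ∈ Finset.range n) =>
      card_filter_keptLayer_eq_self_le C (hM t) (hC t)
    rw [Finset.sum_add_distrib, hrest] at h1
    rw [Finset.sum_add_distrib] at h2
    have h3 := sum_card_filter_layer_eq_self_le n
    simp only [Finset.sum_const, Finset.card_univ, Fintype.card_fin, smul_eq_mul, mul_one] at h1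
    omega

end Construction

theorem theorem2 (n : ℕ) (π : Equiv.Perm (Fin n)) :
    ∃ T : Tangle n, T.Performs π ∧ T.totalMoves ≤ 4 * n := by
  obtain ⟨C, hM, hC, hprod, hcard⟩ := exists_orderedProd_wireMatching n (π * (wireAt n n)⁻¹)
  obtain ⟨T, hT, hmoves⟩ := exists_tangle_of_schedule C hM hC
  rw [hprod, inv_mul_cancel_right] at hT
  exact ⟨T, hT, by omega⟩
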